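/- Let $X$ be a real Banach space, let $\mathcal D_1\subset X$ and $\mathcal D_2\subset\mathbb R^{d_2}$ be compact with $\mathcal D_1\neq\emptyset$, and let $dx$ denote integration over $\mathcal D_1$ against a fixed finite Borel measure on $\mathcal D_1$ that is positive on every nonempty relatively open subset of $\mathcal D_1$ (for instance Lebesgue measure, when $X=\mathbb R^{d_1}$ and $\mathcal D_1$ is the closure of a nonempty bounded open set). For $p\ge 1$ let $$\mathcal T(\phi)=\Big(\int_{\mathcal D_1}\phi_1(x)\,dx,\dots,\int_{\mathcal D_1}\phi_p(x)\,dx\Big)\in\mathbb R^p ,\qquad \phi\in C(\mathcal D_1;\mathbb R^p).$$ Neural operators. A network on a real normed space $E$ with activation $\sigma\in C(\mathbb R)$ and $n\ge1$ hidden layers is a map $x\mapsto W_n\sigma(\cdots W_1\sigma(W_0x+b_0)+b_1\cdots)+b_n$, with $W_0$ a continuous linear map from $E$ to a finite-dimensional space, $W_1,\dots,W_n$ matrices, $b_0,\dots,b_n$ vectors, arbitrary widths, and $\sigma$ acting entrywise. Let $\sigma_1,\sigma_2,\sigma_3\in C(\mathbb R)$ be activations such that, for each of them and for each $d$, there is an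 $n\ge1$ for which the real-valued networks on $\mathbb R^d$ with $n$ hidden layers are dense in $C(K)$ for every compact $K\subset\mathbb R^d$. For $n\ge 2$, the set $\mathcal{NO}_n$ of $n$-layered neural operators $C(\mathcal D_1)\to C(\mathcal D_1;\mathbb R^p)$ consists of the maps $$a\mapsto\int_{\mathcal D_1}\kappa_n(\cdot,y)\,\big(S_{n-1}\sigma_1(\cdots S_2\,\sigma_1(S_1(S_0a))\cdots)\big)(y)\,dy,$$ where each $S_l$ has the form $(S_l\phi)(x)=\int_{\mathcal D_1}\kappa_l(x,y)\phi(y)\,dy+b_l(x)$, the matrix-valued kernels $\kappa_l$ and the vector-valued functions $b_l$ ($0\le l\le n-1$) are networks on $X\times X$ and on $X$ with activation $\sigma_2$, the matrix-valued kernel $\kappa_n$ is a network on $X\times X$ with activation $\sigma_3$, and the intermediate dimensions are arbitrary. Put $\mathcal{NO}=\bigcup_{n\ge2}\mathcal{NO}_n$. Theorem. Let $\mathcal A\subset C(\mathcal D_1)$ be compact and let $G:\mathcal A\to C(\mathcal D_2)$ be a continuous (not necessarily linear) operator. For every $M>0$ and every $\epsilon>0$ (in particular, for every $0<\epsilon\le\min\{4M,4M\|\mathcal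 T\|\}$) there exist a positive integer $p$, a continuous function $\mathbf f:\mathbb R^{d_2}\to\mathbb R^p$ with $\|\mathbf f(y)\|_\infty\le M$ for all $y\in\mathcal D_2$, and a continuous operator $\mathcal G_0\in\mathcal{NO}$ such that $\mathcal T\circ\mathcal G_0:\mathcal A\to\mathbb R^p$ is continuous and $$\sup_{a\in\mathcal A}\big|G(a)(y)-\langle \mathcal T\circ\mathcal G_0(a),\mathbf f(y)\rangle\big|<\epsilon\qquad\text{for all }y\in\mathcal D_2 .$$ -/

import Mathlib

open MeasureTheory

/-- `IsNetwork σ n ι f`: the map `f : E → ℝ^ι` is a feed-forward neural network with activation `σ`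
and `n` hidden layers (of arbitrary widths),
`f x = Wₙ σ(⋯ W₁ σ(W₀ x + b₀) + b₁ ⋯) + bₙ`, where `σ` acts entrywise.  The first affine map starts
from the real normed space `E`; for `E = ℝ^d` this is the usual notion. -/
inductive IsNetwork (σ : C(ℝ, ℝ)) {E : Type*} [NormedAddCommGroup E] [NormedSpace ℝ E] :
    ℕ → (ι : Type) → (E → ι → ℝ) → Prop
  | affine {ι : Type} (W : E →L[ℝ] (ι → ℝ)) (b : ι → ℝ) :
      IsNetwork σ 0 ι (fun x => W x + b)
  | layer {n k : ℕ} {ι : Type} {f : E → Fin k → ℝ} (hf : IsNetwork σ n (Fin k) f)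
      (W : Matrix ι (Fin k) ℝ) (b : ι → ℝ) :
      IsNetwork σ (n + 1) ι (fun x => W.mulVec (fun j => σ (f x j)) + b)

/-- The class of activation functions admitted for neural operators: continuous `σ : ℝ → ℝ` such
that in every dimension `d` there is a number `n ≥ 1` of hidden layers for which the real-valued
`n`-layer networks on `ℝ^d` are dense in `C(K)` for every compact `K ⊆ ℝ^d`. -/
def IsActivation (σ : C(ℝ, ℝ)) : Prop :=
  ∀ d : ℕ, ∃ n : ℕ, 1 ≤ n ∧
    ∀ K : Set (EuclideanSpace ℝ (Fin d)), IsCompact K →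
      ∀ g : EuclideanSpace ℝ (Fin d) → ℝ, ContinuousOn g K → ∀ δ : ℝ, 0 < δ →
        ∃ f : EuclideanSpace ℝ (Fin d) → Fin 1 → ℝ,
          IsNetwork σ n (Fin 1) f ∧ ∀ x ∈ K, |g x - f x 0| < δ

section Operators

variable {X : Type*} [NormedAddCommGroup X] [NormedSpace ℝ X] [MeasurableSpace X] {D : Set X}

/-- Integral operators `(S φ)(x) = ∫_D κ(x, y) φ(y) dy + b(x)` from `C(D; ℝ^k)` to `C(D; ℝ^m)`, whose
matrix-valued kernel `κ` and bias function `b` are neural networks with activation `σ`. -/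
def IsIntegralLayer (σ : C(ℝ, ℝ)) (μ : Measure D) {k m : ℕ}
    (S : C(D, Fin k → ℝ) → C(D, Fin m → ℝ)) : Prop :=
  ∃ (n₁ n₂ : ℕ) (κ : X × X → Fin m × Fin k → ℝ) (b : X → Fin m → ℝ),
    1 ≤ n₁ ∧ 1 ≤ n₂ ∧ IsNetwork σ n₁ (Fin m × Fin k) κ ∧ IsNetwork σ n₂ (Fin m) b ∧
    ∀ (φ : C(D, Fin k → ℝ)) (x : D) (i : Fin m),
      S φ x i = (∫ y : D, ∑ j, κ (x, y) (i, j) * φ y j ∂μ) + b x i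

/-- The entrywise and pointwise application of an activation function: `x ↦ σ (φ x)`. -/
def pointwiseAct (σ : C(ℝ, ℝ)) {k : ℕ} (φ : C(D, Fin k → ℝ)) : C(D, Fin k → ℝ) where
  toFun x i := σ (φ x i)
  continuous_toFun := by fun_prop

/-- The part `a ↦ S_l σ₁(⋯ S₂ σ₁(S₁ (S₀ a)) ⋯)`, `l ≥ 1`, of a neural operator preceding its output
layer, with scalar input functions `a`; each `S_r` is an integral operator whose kernel and bias
are networks with activation `σ₂`. -/
inductive IsHiddenPart (σ₁ σ₂ : C(ℝ, ℝ)) (μ : Measure D) :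
    ℕ → (k : ℕ) → (C(D, ℝ) → C(D, Fin k → ℝ)) → Prop
  | base {k m : ℕ} {S₀ : C(D, Fin 1 → ℝ) → C(D, Fin k → ℝ)}
      {S₁ : C(D, Fin k → ℝ) → C(D, Fin m → ℝ)}
      (h₀ : IsIntegralLayer σ₂ μ S₀) (h₁ : IsIntegralLayer σ₂ μ S₁) :
      IsHiddenPart σ₁ σ₂ μ 1 m (fun a => S₁ (S₀ (ContinuousMap.pi fun _ => a)))
  | step {l k m : ℕ} {H : C(D, ℝ) → C(D, Fin k → ℝ)} {S : C(D, Fin k → ℝ) → C(D, Fin m → ℝ)}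
      (hH : IsHiddenPart σ₁ σ₂ μ l k H) (hS : IsIntegralLayer σ₂ μ S) :
      IsHiddenPart σ₁ σ₂ μ (l + 1) m (fun a => S (pointwiseAct σ₁ (H a)))

/-- `NO_n`: the `n`-layered neural operators from `C(D)` to `C(D; ℝ^p)`,
`a ↦ ∫_D κ_n(·, y) (S_{n-1} σ₁(⋯ S₂ σ₁(S₁ (S₀ a)) ⋯))(y) dy`,
where the kernel `κ_n` is a network with activation `σ₃`. -/
def IsNeuralOperatorOfDepth (σ₁ σ₂ σ₃ : C(ℝ, ℝ)) (μ : Measure D) (n : ℕ) {p : ℕ}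
    (G : C(D, ℝ) → C(D, Fin p → ℝ)) : Prop :=
  ∃ (l k : ℕ) (H : C(D, ℝ) → C(D, Fin k → ℝ)) (r : ℕ) (κ : X × X → Fin p × Fin k → ℝ),
    n = l + 1 ∧ IsHiddenPart σ₁ σ₂ μ l k H ∧ 1 ≤ r ∧ IsNetwork σ₃ r (Fin p × Fin k) κ ∧
    ∀ (a : C(D, ℝ)) (x : D) (i : Fin p),
      G a x i = ∫ y : D, ∑ j, κ (x, y) (i, j) * H a y j ∂μ

/-- `NO = ⋃_{n ≥ 2} NO_n`. -/
def IsNeuralOperator (σ₁ σ₂ σ₃ : C(ℝ, ℝ)) (μ : Measure D) {p : ℕ}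
    (G : C(D, ℝ) → C(D, Fin p → ℝ)) : Prop :=
  ∃ n : ℕ, 2 ≤ n ∧ IsNeuralOperatorOfDepth σ₁ σ₂ σ₃ μ n G

/-- The integral operator `𝒯 φ = (∫_D φ₁, …, ∫_D φ_p)` on vector-valued continuous functions. -/
noncomputable def integralOperator (μ : Measure D) {p : ℕ} (φ : C(D, Fin p → ℝ)) : Fin p → ℝ :=
  fun i => ∫ x : D, φ x i ∂μ

end Operators

/-!
The map `G` is first separated: since `A` is compact, `G(a)(y)` is uniformly close to a finite sum
`∑ gᵢ(a) fᵢ(y)` with continuous `gᵢ` on `A` and continuous `fᵢ` bounded by `M`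
on `D₂` (`exists_separated_sum_near`, a partition of unity). It remains to approximate a continuous
`g : A → ℝ^p` by `𝒯 ∘ G₀` with a neural operator `G₀` (`exists_neuralOperator_near`).

The functionals `a ↦ ∫ u a` with `u ∈ C(D₁)` separate the points of `A`, because the measure charges
every nonempty open set. Hence, by Stone–Weierstrass, `g` is close to `h(∫ u₁ a, …, ∫ u_d a)` for a
continuous `h` on `ℝ^d` (`exists_comp_near_of_separatesPoints`). The weights `u_j` are replaced by
networks with activation `σ₂`: the same lemma, applied to `D₁` and the continuous linear functionals
of `X`, reduces this to networks on `ℝ^n`. Then `h` is replaced by a network with activation `σ₁`.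

Finally, a network of integral functionals is a neural operator
(`isNeuralOperator_const_network`). The layer `S₀` has the kernel `(x, y) ↦ u_j(y)` and turns `a`
into the constant function `(∫ u₁ a, …, ∫ u_d a)`. All later layers have constant kernels, scaled by
`1 / μ(D₁)`, and so act on constant functions as arbitrary affine maps. Constant maps are networks
for every activation, so the output kernel makes no demand on `σ₃`.
-/

/-! ### Operations on networks -/

namespace IsNetwork

variable {σ : C(ℝ, ℝ)} {E E' : Type*} [NormedAddCommGroup E] [NormedSpace ℝ E]
  [NormedAddCommGroup E'] [NormedSpace ℝ E'] {n : ℕ} {ι κ : Type}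

theorem continuous {f : E → ι → ℝ} (hf : IsNetwork σ n ι f) : Continuous f := by
  induction hf with
  | affine W b => fun_prop
  | @layer n k ι f hf W b ih =>
    have h : Continuous fun x j => σ (f x j) :=
      continuous_pi fun j => σ.continuous.comp ((continuous_apply j).comp ih)
    exact (continuous_const.matrix_mulVec h).add continuous_const

/-- Output coordinates of a network may be selected, repeated and permuted. -/
theorem reindex {f : E → ι → ℝ} (hf : IsNetwork σ n ι f) (e : κ → ι) :
    IsNetwork σ n κ (fun x i => f x (e i)) := by
  cases hf with
  | affine W b =>
    exact .affine (ContinuousLinearMap.pi fun i => (ContinuousLinearMap.proj (e i)).comp W)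
      (fun i => b (e i))
  | layer hf W b => exact .layer hf (W.submatrix e id) (fun i => b (e i))

theorem comp_continuousLinearMap {f : E → ι → ℝ} (hf : IsNetwork σ n ι f) (T : E' →L[ℝ] E) :
    IsNetwork σ n ι (fun x => f (T x)) := by
  induction hf with
  | affine W b => exact .affine (W.comp T) b
  | layer hf W b ih => exact .layer ih W b

variable (σ E) in
theorem const (n : ℕ) (c : ι → ℝ) : IsNetwork σ n ι (fun _ : E => c) := by
  induction n generalizing ι with
  | zero => simpa using IsNetwork.affine (σ := σ) (0 : E →L[ℝ] (ι → ℝ)) c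
  | succ n ih => simpa using IsNetwork.layer (ih (ι := Fin 0) 0) 0 c

theorem exists_eq_affine {f : E → ι → ℝ} (hf : IsNetwork σ 0 ι f) :
    ∃ (W : E →L[ℝ] (ι → ℝ)) (b : ι → ℝ), f = fun x => W x + b := by
  cases hf with
  | affine W b => exact ⟨W, b, rfl⟩

theorem exists_eq_layer {f : E → ι → ℝ} (hf : IsNetwork σ (n + 1) ι f) :
    ∃ (k : ℕ) (g : E → Fin k → ℝ) (W : Matrix ι (Fin k) ℝ) (b : ι → ℝ),
      IsNetwork σ n (Fin k) g ∧ f = fun x => W.mulVec (fun j => σ (g x j)) + b := by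
  cases hf with
  | layer hg W b => exact ⟨_, _, W, b, hg, rfl⟩

/-- Scalar networks with the same number of hidden layers can be run in parallel. -/
theorem parallel {J : Type} [Finite J] {f : J → E → Fin 1 → ℝ}
    (hf : ∀ j, IsNetwork σ n (Fin 1) (f j)) : IsNetwork σ n J (fun x j => f j x 0) := by
  induction n generalizing J with
  | zero =>
    choose W b h using fun j => (hf j).exists_eq_affine
    have : (fun x j => f j x 0) = fun x =>
        ContinuousLinearMap.pi (fun j => (ContinuousLinearMap.proj 0).comp (W j)) x
          + fun j => b j 0 := by
      ext x j
      simp [h]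
    rw [this]
    exact .affine _ _
  | succ n ih =>
    classical
    choose k g W b hg h using fun j => (hf j).exists_eq_layer
    -- All hidden units of the given networks, side by side, form the new last hidden layer.
    obtain ⟨K, ⟨e⟩⟩ := Finite.exists_equiv_fin (Σ j, Fin (k j))
    have hG : IsNetwork σ n (Fin K) (fun x q => g (e.symm q).1 x (e.symm q).2) :=
      (ih (f := fun (q : Σ j, Fin (k j)) x _ => g q.1 x q.2)
        fun q => (hg q.1).reindex fun _ => q.2).reindex e.symm
    have : (fun x j => f j x 0) = fun x =>
        (Matrix.of fun j q => ∑ i, if e.symm q = ⟨j, i⟩ then W j 0 i else 0).mulVec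
          (fun q => σ (g (e.symm q).1 x (e.symm q).2)) + fun j => b j 0 := by
      ext x j
      simp only [h, Pi.add_apply, Matrix.mulVec, dotProduct, Matrix.of_apply, Finset.sum_mul]
      rw [Finset.sum_comm]
      congr 1
      refine Finset.sum_congr rfl fun i _ => ?_
      have hs : ∀ s : Σ j, Fin (k j), s = ⟨j, i⟩ → σ (g s.1 x s.2) = σ (g j x i) := by
        rintro _ rfl
        rfl
      rw [Finset.sum_eq_single (e ⟨j, i⟩)]
      · rw [if_pos (e.symm_apply_apply _), hs _ (e.symm_apply_apply _)]
      · intro q _ hq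
        rw [if_neg, zero_mul]
        rintro h'
        exact hq (by rw [← h', e.apply_symm_apply])
      · simp
    rw [this]
    exact .layer hG _ _

end IsNetwork

/-! ### Universal approximation by networks -/

/-- Networks with an admissible activation approximate vector-valued continuous functions on
compact subsets of `ℝ^d`, all output coordinates at once. -/
theorem IsActivation.exists_network_near {σ : C(ℝ, ℝ)} (hσ : IsActivation σ) {d m : ℕ}
    {K : Set (Fin d → ℝ)} (hK : IsCompact K) {h : (Fin d → ℝ) → Fin m → ℝ} (hh : Continuous h)
    {δ : ℝ} (hδ : 0 < δ) :
    ∃ (n : ℕ) (f : (Fin d → ℝ) → Fin m → ℝ), 1 ≤ n ∧ IsNetwork σ n (Fin m) f ∧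
      ∀ v ∈ K, ∀ i, |h v i - f v i| < δ := by
  obtain ⟨n, hn, H⟩ := hσ d
  let e : EuclideanSpace ℝ (Fin d) ≃L[ℝ] (Fin d → ℝ) := EuclideanSpace.equiv (Fin d) ℝ
  have hK' : IsCompact (e.symm '' K) := hK.image e.symm.continuous
  choose f hf hfK using fun i : Fin m => H _ hK' (fun x => h (e x) i)
    (((continuous_apply i).comp (hh.comp e.continuous)).continuousOn) δ hδ
  refine ⟨n, fun v i => f i (e.symm v) 0, hn,
    (IsNetwork.parallel hf).comp_continuousLinearMap 
      (e.symm : (Fin d → ℝ) →L[ℝ] EuclideanSpace ℝ (Fin d)), fun v hv i => ?_⟩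
  simpa using hfK i (e.symm v) ⟨v, hv, rfl⟩

/-- A vector-valued continuous function on a compact space `K` is, up to a uniform error, a
continuous function of finitely many members of a given point-separating family `F`: by the
Stone–Weierstrass theorem one may even take polynomials. -/
theorem exists_comp_near_of_separatesPoints {K : Type*} [TopologicalSpace K] [CompactSpace K]
    {F : Set C(K, ℝ)} (hF : ∀ x y : K, x ≠ y → ∃ u ∈ F, u x ≠ u y) {m : ℕ}
    (ψ : C(K, Fin m → ℝ)) {δ : ℝ} (hδ : 0 < δ) :
    ∃ (d : ℕ) (L : Fin d → C(K, ℝ)) (h : (Fin d → ℝ) → Fin m → ℝ), (∀ j, L j ∈ F) ∧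
      Continuous h ∧ ∀ x i, |ψ x i - h (fun j => L j x) i| < δ := by
  classical
  have hsep : (Algebra.adjoin ℝ F).SeparatesPoints := by
    intro x y hxy
    obtain ⟨u, hu, hne⟩ := hF x y hxy
    exact ⟨u, ⟨u, Algebra.subset_adjoin hu, rfl⟩, hne⟩
  have haeval : ∀ (q : MvPolynomial F ℝ) (x : K),
      MvPolynomial.aeval (fun u : F => (u : C(K, ℝ))) q x
        = MvPolynomial.eval (fun u : F => (u : C(K, ℝ)) x) q := by
    intro q x
    induction q using MvPolynomial.induction_on with
    | C a => simp
    | add p q hp hq => simp [hp, hq]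
    | mul_X p u hp => simp [hp]
  have hq : ∀ i, ∃ q : MvPolynomial F ℝ,
      ∀ x, |ψ x i - MvPolynomial.eval (fun u : F => (u : C(K, ℝ)) x) q| < δ := by
    intro i
    obtain ⟨⟨g, hg⟩, hgδ⟩ := ContinuousMap.exists_mem_subalgebra_near_continuous_of_separatesPoints
      _ hsep (fun x => ψ x i) (by fun_prop) δ hδ
    rw [Algebra.adjoin_eq_range] at hg
    obtain ⟨q, rfl⟩ := hg
    refine ⟨q, fun x => ?_⟩
    rw [← haeval, abs_sub_comm]
    exact hgδ x
  choose q hq using hq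
  let V : Finset F := Finset.univ.biUnion fun i => (q i).vars
  let e := V.equivFin
  refine ⟨V.card, fun j => ((e.symm j : F) : C(K, ℝ)),
    fun v i => MvPolynomial.eval (fun u => if hu : u ∈ V then v (e ⟨u, hu⟩) else 0) (q i),
    fun j => (e.symm j : F).2, ?_, fun x i => ?_⟩
  · refine continuous_pi fun i => (MvPolynomial.continuous_eval (q i)).comp ?_
    refine continuous_pi fun u => ?_
    split_ifs <;> fun_prop
  · have : MvPolynomial.eval (fun u : F => if hu : u ∈ V then
          ((e.symm (e ⟨u, hu⟩) : F) : C(K, ℝ)) x else 0) (q i)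
        = MvPolynomial.eval (fun u : F => (u : C(K, ℝ)) x) (q i) := by
      refine MvPolynomial.eval₂Hom_congr' rfl (fun u hu _ => ?_) rfl
      have huV : u ∈ V := Finset.mem_biUnion.2 ⟨i, Finset.mem_univ _, hu⟩
      simp [huV]
    simpa only [this] using hq i x

/-- Networks on a normed space `X` approximate vector-valued continuous functions on a compact
`D ⊆ X`: by Hahn–Banach the continuous linear functionals separate the points of `D`. -/
theorem IsActivation.exists_network_near_on_compact {σ : C(ℝ, ℝ)} (hσ : IsActivation σ)
    {X : Type*} [NormedAddCommGroup X] [NormedSpace ℝ X] {D : Set X} (hD : IsCompact D)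
    {m : ℕ} (ψ : C(D, Fin m → ℝ)) {δ : ℝ} (hδ : 0 < δ) :
    ∃ (n : ℕ) (f : X → Fin m → ℝ), 1 ≤ n ∧ IsNetwork σ n (Fin m) f ∧
      ∀ (x : D) (i : Fin m), |ψ x i - f x i| < δ := by
  have : CompactSpace D := isCompact_iff_compactSpace.1 hD
  obtain ⟨d, L, h, hL, hh, hψ⟩ := exists_comp_near_of_separatesPoints
    (F := Set.range fun ℓ : X →L[ℝ] ℝ => (⟨fun x : D => ℓ x, by fun_prop⟩ : C(D, ℝ)))
    (fun x y hxy => by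
      obtain ⟨ℓ, hℓ⟩ := SeparatingDual.exists_separating_of_ne (R := ℝ)
        (Subtype.coe_injective.ne hxy)
      exact ⟨_, ⟨ℓ, rfl⟩, hℓ⟩) ψ (half_pos hδ)
  choose ℓ hℓ using hL
  let T : X →L[ℝ] (Fin d → ℝ) := ContinuousLinearMap.pi ℓ
  obtain ⟨n, f, hn, hf, hfT⟩ := hσ.exists_network_near (hD.image T.continuous) hh (half_pos hδ)
  refine ⟨n, fun x => f (T x), hn, hf.comp_continuousLinearMap T, fun x i => ?_⟩
  have h₁ := hψ x i
  have h₂ := hfT (T x) ⟨x, x.2, rfl⟩ i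
  have h₃ : (fun j => L j x) = T x := by
    ext j
    simp [T, ← hℓ]
  rw [h₃] at h₁
  calc |ψ x i - f (T x) i| ≤ |ψ x i - h (T x) i| + |h (T x) i - f (T x) i| := abs_sub_le _ _ _
    _ < δ := by linarith

section NeuralOperators

/-! ### Neural operators with constant output functions -/

/-- The integral operator with constant kernel `W / μ(D)` and constant bias `b`. It sends `φ` to the
constant function with value `W` applied to the mean of `φ`, plus `b`. -/
noncomputable def averagingLayer {X : Type*} [TopologicalSpace X] [MeasurableSpace X] {D : Set X}
    (μ : Measure D) {k m : ℕ} (W : Matrix (Fin m) (Fin k) ℝ)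
    (b : Fin m → ℝ) (φ : C(D, Fin k → ℝ)) : C(D, Fin m → ℝ) :=
  ContinuousMap.const D fun i => (∫ y : D, ∑ j, (μ.real Set.univ)⁻¹ * W i j * φ y j ∂μ) + b i

theorem averagingLayer_const {X : Type*} [TopologicalSpace X] [MeasurableSpace X] {D : Set X}
    (μ : Measure D) (hμ : μ.real Set.univ ≠ 0) {k m : ℕ}
    (W : Matrix (Fin m) (Fin k) ℝ) (b : Fin m → ℝ) (v : Fin k → ℝ) :
    averagingLayer μ W b (ContinuousMap.const D v) = ContinuousMap.const D (W.mulVec v + b) := by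
  ext x i
  simp only [averagingLayer, ContinuousMap.const_apply, Pi.add_apply, integral_const, smul_eq_mul,
    Matrix.mulVec, dotProduct, Finset.mul_sum]
  congr 1
  refine Finset.sum_congr rfl fun j _ => ?_
  field_simp

variable {X : Type*} [NormedAddCommGroup X] [NormedSpace ℝ X] [MeasurableSpace X] {D : Set X}

theorem isIntegralLayer_averagingLayer (σ : C(ℝ, ℝ)) (μ : Measure D) {k m : ℕ}
    (W : Matrix (Fin m) (Fin k) ℝ) (b : Fin m → ℝ) :
    IsIntegralLayer σ μ (averagingLayer μ W b) :=
  ⟨1, 1, fun _ p => (μ.real Set.univ)⁻¹ * W p.1 p.2, fun _ => b, le_rfl, le_rfl,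
    IsNetwork.const σ _ 1 _, IsNetwork.const σ _ 1 _, fun _ _ _ => rfl⟩

/-- The integral functionals `a ↦ (∫ f₁ a, …, ∫ f_d a)` with weights `f₁, …, f_d`. -/
noncomputable def integralFunctionals (μ : Measure D) {d : ℕ} (f : X → Fin d → ℝ) (a : C(D, ℝ)) :
    Fin d → ℝ :=
  fun i => ∫ y : D, f y i * a y ∂μ

/-- Any network `N` with activation `σ₁`, applied to integral functionals whose weights form a
network with activation `σ₂`, occurs as the hidden part of a neural operator with constant output.
The layer `S₀` evaluates the functionals; all later layers have constant kernels, and so act on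
constant functions as the affine maps of `N`. The map `e` selects output coordinates. -/
theorem isHiddenPart_const_network (σ₁ σ₂ : C(ℝ, ℝ)) (μ : Measure D) (hμ : μ.real Set.univ ≠ 0)
    {d r : ℕ} (hr : 1 ≤ r) {f : X → Fin d → ℝ} (hf : IsNetwork σ₂ r (Fin d) f) {n : ℕ} {ι : Type}
    {N : (Fin d → ℝ) → ι → ℝ} (hN : IsNetwork σ₁ n ι N) {k : ℕ} (e : Fin k → ι) :
    IsHiddenPart σ₁ σ₂ μ (n + 1) k
      (fun a => ContinuousMap.const D fun i => N (integralFunctionals μ f a) (e i)) := by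
  induction hN generalizing k with
  | @affine ι W b =>
    have h₀ : IsIntegralLayer σ₂ μ (fun φ : C(D, Fin 1 → ℝ) =>
        ContinuousMap.const D fun i => ∫ y : D, f y i * φ y 0 ∂μ) :=
      ⟨r, 1, fun p q => f p.2 q.1, fun _ => 0, hr, le_rfl,
        (hf.reindex Prod.fst).comp_continuousLinearMap (ContinuousLinearMap.snd ℝ X X),
        IsNetwork.const σ₂ _ 1 _, fun φ x i => by simp⟩
    convert IsHiddenPart.base h₀ (isIntegralLayer_averagingLayer σ₂ μ
      (Matrix.of fun i j => W (Pi.single j 1) (e i)) fun i => b (e i)) using 1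
    ext a x i
    rw [averagingLayer_const μ hμ]
    have h := congrFun (LinearMap.pi_apply_eq_sum_univ (W : (Fin d → ℝ) →ₗ[ℝ] (ι → ℝ))
      (integralFunctionals μ f a)) (e i)
    have hs : ∀ j : Fin d, (fun l => if j = l then (1 : ℝ) else 0) = Pi.single j 1 := by
      intro j
      ext l
      simp [Pi.single_apply, eq_comm]
    simp only [hs, ContinuousLinearMap.coe_coe, Finset.sum_apply, Pi.smul_apply, smul_eq_mul] at h
    simp only [ContinuousMap.const_apply, Pi.add_apply, h, Matrix.mulVec, dotProduct,
      Matrix.of_apply]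
    exact congrArg (· + _) (Finset.sum_congr rfl fun j _ => mul_comm _ _)
  | @layer n l ι g hg W b ih =>
    convert IsHiddenPart.step (ih id) (isIntegralLayer_averagingLayer σ₂ μ
      (W.submatrix e id) fun i => b (e i)) using 1
    ext a x i
    have : pointwiseAct σ₁ (ContinuousMap.const D fun i => g (integralFunctionals μ f a) (id i))
        = ContinuousMap.const D fun i => σ₁ (g (integralFunctionals μ f a) i) := rfl
    rw [this, averagingLayer_const μ hμ]
    rfl

/-- A network of integral functionals, viewed as an operator with constant output functions, is a
neural operator. The factor `c` is arbitrary: it is absorbed in the output kernel. -/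
theorem isNeuralOperator_const_network (σ₁ σ₂ σ₃ : C(ℝ, ℝ)) (μ : Measure D)
    (hμ : μ.real Set.univ ≠ 0) {d r : ℕ} (hr : 1 ≤ r) {f : X → Fin d → ℝ}
    (hf : IsNetwork σ₂ r (Fin d) f) {n p : ℕ} {N : (Fin d → ℝ) → Fin p → ℝ}
    (hN : IsNetwork σ₁ n (Fin p) N) (c : ℝ) :
    IsNeuralOperator σ₁ σ₂ σ₃ μ
      (fun a => ContinuousMap.const D (c • N (integralFunctionals μ f a))) := by
  refine ⟨n + 2, by omega, n + 1, p, _, 1,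
    fun _ q => (μ.real Set.univ)⁻¹ * (c * (1 : Matrix (Fin p) (Fin p) ℝ) q.1 q.2), rfl,
    isHiddenPart_const_network σ₁ σ₂ μ hμ hr hf hN id, le_rfl, IsNetwork.const σ₃ _ 1 _,
    fun a x i => ?_⟩
  simp only [ContinuousMap.const_apply, Pi.smul_apply, smul_eq_mul, integral_const, id,
    Matrix.one_apply, mul_ite, ite_mul, mul_one, mul_zero, zero_mul, Finset.sum_ite_eq,
    Finset.mem_univ, if_true]
  field_simp

end NeuralOperators

/-! ### Integral functionals -/

section Functionals

variable {Y : Type*} [TopologicalSpace Y] [CompactSpace Y] [MeasurableSpace Y] [BorelSpace Y]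
  (μ : Measure Y) [IsFiniteMeasure μ]

theorem integrable_continuousMap_mul (u v : C(Y, ℝ)) : Integrable (fun x => u x * v x) μ :=
  (by fun_prop : Continuous fun x => u x * v x).integrable_of_hasCompactSupport
    (HasCompactSupport.of_compactSpace _)

/-- Changing the weight of an integral functional by at most `η` changes its value at `a` by at most
`η * ‖a‖ * μ(Y)`. -/
theorem abs_integral_mul_sub_le {u v : C(Y, ℝ)} {η : ℝ} (h : ∀ x, |u x - v x| ≤ η) (a : C(Y, ℝ)) :
    |(∫ x, u x * a x ∂μ) - ∫ x, v x * a x ∂μ| ≤ η * ‖a‖ * μ.real Set.univ := by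
  rw [← integral_sub (integrable_continuousMap_mul μ u a) (integrable_continuousMap_mul μ v a),
    ← Real.norm_eq_abs]
  refine norm_integral_le_of_norm_le_const (Filter.Eventually.of_forall fun x => ?_)
  rw [← sub_mul, norm_mul]
  exact mul_le_mul (h x) (a.norm_coe_le_norm x) (norm_nonneg _) ((abs_nonneg _).trans (h x))

theorem continuous_integral_mul (u : C(Y, ℝ)) :
    Continuous fun a : C(Y, ℝ) => ∫ x, u x * a x ∂μ := by
  refine (LipschitzWith.of_dist_le' (K := μ.real Set.univ * ‖u‖) fun a b => ?_).continuous
  have h := abs_integral_mul_sub_le μ (u := a) (v := b) (η := dist a b)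
    (fun x => by rw [← Real.dist_eq]; exact ContinuousMap.dist_apply_le_dist x) u
  simp only [mul_comm _ (u _)] at h
  rw [Real.dist_eq]
  linarith

/-- If `μ` charges every nonempty open set, the functionals `a ↦ ∫ u a` separate continuous
functions: take `u = a - b`. -/
theorem exists_integral_mul_ne [μ.IsOpenPosMeasure] {a b : C(Y, ℝ)} (hab : a ≠ b) :
    ∃ u : C(Y, ℝ), ∫ x, u x * a x ∂μ ≠ ∫ x, u x * b x ∂μ := by
  refine ⟨a - b, sub_ne_zero.1 ?_⟩
  rw [← integral_sub (integrable_continuousMap_mul μ _ a) (integrable_continuousMap_mul μ _ b)]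
  obtain ⟨x, hx⟩ := DFunLike.ne_iff.1 hab
  refine (Continuous.integral_pos_of_hasCompactSupport_nonneg_nonzero (x := x) (by fun_prop)
    (HasCompactSupport.of_compactSpace _) (fun y => ?_) ?_).ne'
  · simpa [← mul_sub] using mul_self_nonneg (a y - b y)
  · simpa [← mul_sub, sub_eq_zero] using hx

end Functionals

/-! ### Approximation by neural operators -/

section Approximation

variable {X : Type*} [NormedAddCommGroup X] [NormedSpace ℝ X] [MeasurableSpace X] [BorelSpace X]
  {D : Set X}

/-- **Approximation of finite-dimensional maps by neural operators.** On a compact set `A`, every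
continuous `g : A → ℝ^p` is uniformly approximated by `𝒯 ∘ G₀` with `G₀` a continuous neural
operator. -/
theorem exists_neuralOperator_near {σ₁ σ₂ : C(ℝ, ℝ)} (σ₃ : C(ℝ, ℝ)) (hσ₁ : IsActivation σ₁)
    (hσ₂ : IsActivation σ₂) (hD : IsCompact D) (hne : D.Nonempty) (μ : Measure D)
    [IsFiniteMeasure μ] [μ.IsOpenPosMeasure] {A : Set C(D, ℝ)} (hA : IsCompact A) {p : ℕ}
    (g : C(A, Fin p → ℝ)) {δ : ℝ} (hδ : 0 < δ) :
    ∃ G₀ : C(D, ℝ) → C(D, Fin p → ℝ), IsNeuralOperator σ₁ σ₂ σ₃ μ G₀ ∧ Continuous G₀ ∧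
      Continuous (fun a => integralOperator μ (G₀ a)) ∧
      ∀ (a : A) (i : Fin p), |g a i - integralOperator μ (G₀ a) i| < δ := by
  have : CompactSpace D := isCompact_iff_compactSpace.1 hD
  have : CompactSpace A := isCompact_iff_compactSpace.1 hA
  have : Nonempty D := hne.to_subtype
  have hμ : μ.real Set.univ ≠ 0 :=
    ENNReal.toReal_ne_zero.2 ⟨isOpen_univ.measure_ne_zero μ Set.univ_nonempty, measure_ne_top _ _⟩
  -- `g` is nearly a continuous function `h` of finitely many integral functionals.
  obtain ⟨d, L, h, hL, hh, hg⟩ := exists_comp_near_of_separatesPoints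
    (F := Set.range fun u : C(D, ℝ) => (⟨fun a : A => ∫ x, u x * (a : C(D, ℝ)) x ∂μ,
      (continuous_integral_mul μ u).comp continuous_subtype_val⟩ : C(A, ℝ)))
    (fun a b hab => by
      obtain ⟨u, hu⟩ := exists_integral_mul_ne μ (Subtype.coe_injective.ne hab)
      exact ⟨_, ⟨u, rfl⟩, hu⟩) g (by positivity : 0 < δ / 3)
  choose u hu using hL
  -- A modulus of continuity of `h` along the compact image of `A`.
  have hK : IsCompact (Set.range fun (a : A) j => L j a) :=
    isCompact_range (by fun_prop)
  obtain ⟨η, hη, hhη⟩ := Metric.mem_uniformity_dist.1 (hK.uniformContinuousAt_of_continuousAt h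
    (fun _ _ => hh.continuousAt) (Metric.dist_mem_uniformity (by positivity : 0 < δ / 3)))
  obtain ⟨R, hR⟩ := hA.isBounded.exists_norm_le
  -- Replace the weights by networks, accurately enough for this modulus.
  set η' : ℝ := η / ((|R| + 1) * (μ.real Set.univ + 1)) with hη'
  have hη'pos : 0 < η' := by positivity
  obtain ⟨r, f, hr, hf, hfu⟩ := hσ₂.exists_network_near_on_compact hD
    (⟨fun x j => u j x, by fun_prop⟩ : C(D, Fin d → ℝ)) hη'pos
  have hcont : Continuous (integralFunctionals μ f) := continuous_pi fun i =>
    continuous_integral_mul μ ⟨fun x : D => f x i, by have := hf.continuous; fun_prop⟩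
  obtain ⟨n, N, -, hN, hNh⟩ := hσ₁.exists_network_near (hA.image hcont) hh
    (by positivity : 0 < δ / 3)
  have hNcont : Continuous fun a => N (integralFunctionals μ f a) := hN.continuous.comp hcont
  -- The factor compensates the integration of a constant function by `𝒯`.
  have hT : ∀ a, integralOperator μ (ContinuousMap.const D
      ((μ.real Set.univ)⁻¹ • N (integralFunctionals μ f a))) = N (integralFunctionals μ f a) := by
    intro a
    ext i
    simp [integralOperator, hμ]
  refine ⟨_, isNeuralOperator_const_network σ₁ σ₂ σ₃ μ hμ hr hf hN (μ.real Set.univ)⁻¹, ?_, ?_, ?_⟩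
  · exact ContinuousMap.continuous_const'.comp
      ((continuous_const_smul (μ.real Set.univ)⁻¹).comp hNcont)
  · simpa only [hT] using hNcont
  · intro a i
    rw [hT]
    have hclose : dist (fun j => L j a) (integralFunctionals μ f a) < η := by
      refine (dist_pi_lt_iff hη).2 fun j => ?_
      rw [Real.dist_eq, ← hu]
      refine (abs_integral_mul_sub_le μ (u := u j) (v := ⟨fun x : D => f x j, by
        have := hf.continuous; fun_prop⟩) (fun x => (hfu x j).le) a).trans_lt ?_
      have h₁ : ‖(a : C(D, ℝ))‖ ≤ |R| := (hR a a.2).trans (le_abs_self R)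
      have h₂ : 0 ≤ μ.real Set.univ := measureReal_nonneg
      rw [mul_assoc, hη', div_mul_eq_mul_div, div_lt_iff₀ (by positivity)]
      refine mul_lt_mul_of_pos_left ?_ hη
      calc ‖(a : C(D, ℝ))‖ * μ.real Set.univ ≤ |R| * μ.real Set.univ := by gcongr
        _ < (|R| + 1) * (μ.real Set.univ + 1) := by nlinarith [abs_nonneg R]
    have h₁ := hg a i
    have h₂ := ((dist_pi_lt_iff (by positivity)).1 (hhη hclose ⟨a, rfl⟩)) i
    have h₃ := hNh _ ⟨a, a.2, rfl⟩ i
    rw [Real.dist_eq] at h₂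
    rw [abs_lt] at *
    constructor <;> linarith [h₁.1, h₁.2, h₂.1, h₂.2, h₃.1, h₃.2]

end Approximation

/-! ### Separation of variables -/

/-- A continuous map from a compact space `K` to `C(D₂)` is uniformly close to a finite sum
`∑ gᵢ(a) fᵢ(y)`: choose `fᵢ = G(aᵢ)` along a net, and for `gᵢ` a partition of unity subordinate
to the sets where `G` is close to `fᵢ`. The `fᵢ` are extended by Tietze's theorem and scaled so
as to be bounded by `M` on `D₂`; the `gᵢ` absorb the inverse factor. -/
theorem exists_separated_sum_near {K E : Type*} [TopologicalSpace K] [CompactSpace K]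
    [TopologicalSpace E] [T2Space E] [NormalSpace E] {D₂ : Set E} (hD₂ : IsCompact D₂)
    {G : K → C(D₂, ℝ)} (hG : Continuous G) {M : ℝ} (hM : 0 < M) {ε : ℝ} (hε : 0 < ε) :
    ∃ (p : ℕ) (g : C(K, Fin p → ℝ)) (f : E → Fin p → ℝ), Continuous f ∧
      (∀ y ∈ D₂, ‖f y‖ ≤ M) ∧ ∀ (a : K) (y : D₂), |G a y - g a ⬝ᵥ f y| ≤ ε := by
  have : CompactSpace D₂ := isCompact_iff_compactSpace.1 hD₂
  obtain ⟨t, ht⟩ := CompactSpace.elim_nhds_subcover (fun b : K => {a | dist (G a) (G b) < ε})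
    fun b => (isOpen_lt (by fun_prop) continuous_const).mem_nhds (by simpa using hε)
  let c : Fin t.card → K := fun i => t.equivFin.symm i
  let ρ : Fin t.card → K → ℝ := fun i a => max 0 (ε - dist (G a) (G (c i)))
  have hρc : ∀ i, Continuous (ρ i) := fun i => by fun_prop
  have hρ0 : ∀ i a, 0 ≤ ρ i a := fun i a => le_max_left _ _
  have hs : ∀ a, 0 < ∑ i, ρ i a := by
    intro a
    obtain ⟨b, hb, hab⟩ := Set.mem_iUnion₂.1 (ht.ge (Set.mem_univ a))
    refine Finset.sum_pos' (fun i _ => hρ0 i a) ⟨t.equivFin ⟨b, hb⟩, Finset.mem_univ _, ?_⟩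
    exact lt_max_of_lt_right (by simpa [c] using hab)
  choose F hF using fun i => ContinuousMap.exists_restrict_eq hD₂.isClosed (G (c i))
  have hFG : ∀ i (y : D₂), F i y = G (c i) y := fun i y => by rw [← hF]; rfl
  obtain ⟨B, hB⟩ : ∃ B, ∀ i, ‖G (c i)‖ ≤ B :=
    ⟨∑ i, ‖G (c i)‖, fun i => Finset.single_le_sum (f := fun i => ‖G (c i)‖)
      (fun _ _ => norm_nonneg _) (Finset.mem_univ i)⟩
  set q : ℝ := M / (|B| + 1) with hq
  have hq0 : 0 < q := by positivity
  refine ⟨t.card, ⟨fun a i => q⁻¹ * (ρ i a / ∑ i, ρ i a), ?_⟩, fun y i => q * F i y, by fun_prop,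
    fun y hy => (pi_norm_le_iff_of_nonneg hM.le).2 fun i => ?_, fun a y => ?_⟩
  · exact continuous_pi fun i => continuous_const.mul ((hρc i).div
      (continuous_finsetSum _ fun i _ => hρc i) fun a => (hs a).ne')
  · change ‖q * F i y‖ ≤ M
    rw [hFG i ⟨y, hy⟩, norm_mul, Real.norm_of_nonneg hq0.le, hq, div_mul_eq_mul_div,
      div_le_iff₀ (by positivity)]
    gcongr
    exact ((G (c i)).norm_coe_le_norm _).trans (((hB i).trans (le_abs_self B)).trans (by linarith))
  · have hsum : (fun i => q⁻¹ * (ρ i a / ∑ i, ρ i a)) ⬝ᵥ (fun i => q * F i y)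
        = (∑ i, ρ i a * G (c i) y) / ∑ i, ρ i a := by
      rw [dotProduct, Finset.sum_div]
      refine Finset.sum_congr rfl fun i _ => ?_
      rw [hFG]
      field_simp
    have hterm : ∀ i, |ρ i a * (G a y - G (c i) y)| ≤ ρ i a * ε := by
      intro i
      rw [abs_mul, abs_of_nonneg (hρ0 i a)]
      -- Either the weight vanishes, or `G a` is within `ε` of `G (c i)`.
      rcases le_total ε (dist (G a) (G (c i))) with h | h
      · simp [ρ, h]
      · exact mul_le_mul_of_nonneg_left ((ContinuousMap.dist_apply_le_dist y).trans h) (hρ0 i a)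
    have hdiff : G a y - (∑ i, ρ i a * G (c i) y) / ∑ i, ρ i a
        = (∑ i, ρ i a * (G a y - G (c i) y)) / ∑ i, ρ i a := by
      rw [eq_div_iff (hs a).ne', sub_mul, div_mul_cancel₀ _ (hs a).ne']
      simp only [mul_sub, Finset.sum_sub_distrib, ← Finset.sum_mul]
      ring
    change |G a y - (fun i => q⁻¹ * (ρ i a / ∑ i, ρ i a)) ⬝ᵥ (fun i => q * F i y)| ≤ ε
    rw [hsum, hdiff, abs_div, abs_of_pos (hs a), div_le_iff₀ (hs a), mul_comm ε, Finset.sum_mul]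
    exact (Finset.abs_sum_le_sum_abs _ _).trans (Finset.sum_le_sum fun i _ => hterm i)

/-! ### The approximation theorem -/

theorem theorem2 {X : Type*} [NormedAddCommGroup X] [NormedSpace ℝ X] [CompleteSpace X]
    [MeasurableSpace X] [BorelSpace X] {d₂ : ℕ}
    (σ₁ σ₂ σ₃ : C(ℝ, ℝ)) (hσ₁ : IsActivation σ₁) (hσ₂ : IsActivation σ₂) (hσ₃ : IsActivation σ₃)
    (D₁ : Set X) (hD₁ : IsCompact D₁) (hD₁ne : D₁.Nonempty)
    (μ : Measure D₁) [IsFiniteMeasure μ] [μ.IsOpenPosMeasure]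
    (D₂ : Set (EuclideanSpace ℝ (Fin d₂))) (hD₂ : IsCompact D₂)
    (A : Set C(D₁, ℝ)) (hA : IsCompact A)
    (G : A → C(D₂, ℝ)) (hG : Continuous G)
    (M : ℝ) (hM : 0 < M) (ε : ℝ) (hε : 0 < ε) :
    ∃ (p : ℕ) (f : EuclideanSpace ℝ (Fin d₂) → Fin p → ℝ) (G₀ : C(D₁, ℝ) → C(D₁, Fin p → ℝ)),
      0 < p ∧ Continuous f ∧ (∀ y ∈ D₂, ‖f y‖ ≤ M) ∧
      IsNeuralOperator σ₁ σ₂ σ₃ μ G₀ ∧ Continuous G₀ ∧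
      Continuous (fun a : A => integralOperator μ (G₀ a)) ∧
      ∀ y : D₂,
        BddAbove (Set.range fun a : A => |G a y - integralOperator μ (G₀ a) ⬝ᵥ f y|) ∧
        ⨆ a : A, |G a y - integralOperator μ (G₀ a) ⬝ᵥ f y| < ε := by
  have : CompactSpace A := isCompact_iff_compactSpace.1 hA
  -- It is enough to bound the error pointwise, by a constant below `ε`.
  suffices H : ∃ (p : ℕ) (f : EuclideanSpace ℝ (Fin d₂) → Fin p → ℝ)
      (G₀ : C(D₁, ℝ) → C(D₁, Fin p → ℝ)),
      0 < p ∧ Continuous f ∧ (∀ y ∈ D₂, ‖f y‖ ≤ M) ∧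
      IsNeuralOperator σ₁ σ₂ σ₃ μ G₀ ∧ Continuous G₀ ∧
      Continuous (fun a => integralOperator μ (G₀ a)) ∧
      ∀ (y : D₂) (a : A), |G a y - integralOperator μ (G₀ a) ⬝ᵥ f y| ≤ 2 * ε / 3 by
    obtain ⟨p, f, G₀, hp, hf, hfM, hG₀, hG₀c, hT, h⟩ := H
    exact ⟨p, f, G₀, hp, hf, hfM, hG₀, hG₀c, hT.comp continuous_subtype_val, fun y =>
      ⟨⟨2 * ε / 3, by rintro _ ⟨a, rfl⟩; exact h y a⟩,
        (Real.iSup_le (h y) (by positivity)).trans_lt (by linarith)⟩⟩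
  obtain ⟨p, g, f, hf, hfM, hgf⟩ := exists_separated_sum_near hD₂ hG hM (by positivity : 0 < ε / 3)
  rcases Nat.eq_zero_or_pos p with rfl | hp
  · -- An empty sum is already accurate, and is padded by one vanishing term.
    obtain ⟨G₀, hG₀, hG₀c, hT, -⟩ := exists_neuralOperator_near σ₃ hσ₁ hσ₂ hD₁ hD₁ne μ hA
      (0 : C(A, Fin 1 → ℝ)) one_pos
    refine ⟨1, 0, G₀, one_pos, continuous_zero, fun y _ => by simpa using hM.le, hG₀, hG₀c, hT,
      fun y a => ?_⟩
    have := hgf a y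
    simp only [Matrix.dotProduct_of_isEmpty, sub_zero] at this
    simp only [Pi.zero_apply, dotProduct_zero, sub_zero]
    linarith
  · obtain ⟨G₀, hG₀, hG₀c, hT, h⟩ := exists_neuralOperator_near σ₃ hσ₁ hσ₂ hD₁ hD₁ne μ hA g
      (by positivity : 0 < ε / (3 * p * M))
    refine ⟨p, f, G₀, hp, hf, hfM, hG₀, hG₀c, hT, fun y a => ?_⟩
    have h₁ : |(g a - integralOperator μ (G₀ a)) ⬝ᵥ f y| ≤ ε / 3 := by
      calc _ ≤ ∑ i, |(g a - integralOperator μ (G₀ a)) i * f y i| :=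
            Finset.abs_sum_le_sum_abs _ _
        _ ≤ ∑ _i : Fin p, ε / (3 * p * M) * M := by
            refine Finset.sum_le_sum fun i _ => ?_
            rw [abs_mul]
            exact mul_le_mul (h a i).le ((norm_le_pi_norm (f y) i).trans (hfM y y.2))
              (abs_nonneg _) (by positivity)
        _ = ε / 3 := by
            rw [Finset.sum_const, Finset.card_univ, Fintype.card_fin, nsmul_eq_mul]
            field_simp
    have h₂ := hgf a y
    rw [sub_dotProduct] at h₁
    rw [abs_le] at *
    constructor <;> linarith [h₁.1, h₁.2, h₂.1, h₂.2]
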